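/- Let $n\ge 2$ be an integer and set $p_*=\infty$ if $n=2$ and $p_*=\frac{n+2}{n-2}$ if $n\ge 3$. Let $1<p<p_*$, $\lambda>0$ and $\beta\ge 0$ be real numbers. If $u\in C^2(\mathbb R^n)$ is a nonnegative classical solution of $$\Delta u-\lambda\, x\cdot\nabla u+u^p-\beta u=0\qquad\text{on } \mathbb R^n,$$ then for every $\gamma>0$ $$\int_{\mathbb R^n}\left(u^{p+1}+|\nabla u|^2\right)e^{-\gamma|x|^2}\,dx<\infty .$$ -/

import Mathlib

open MeasureTheory

/-- The Sobolev exponent `p_*` in dimension `n`: it is `∞` for `n ≤ 2` and `(n + 2) / (n - 2)`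
for `n ≥ 3`. -/
noncomputable def sobolevExponent (n : ℕ) : EReal :=
  if n ≤ 2 then ⊤ else ((((n : ℝ) + 2) / ((n : ℝ) - 2) : ℝ) : EReal)

/-- `u` is a nonnegative classical (i.e. `C²`) solution of
`Δ u - lam * x · ∇ u + u ^ p - β * u = 0` on the whole of `ℝⁿ`. -/
structure IsNonnegClassicalSolution (n : ℕ) (p lam β : ℝ)
    (u : EuclideanSpace ℝ (Fin n) → ℝ) : Prop where
  contDiff : ContDiff ℝ 2 u
  nonneg : ∀ x, 0 ≤ u x
  equation : ∀ x, Laplacian.laplacian u x - lam * inner ℝ x (gradient u x)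
    + u x ^ p - β * u x = 0

/-!
The estimate is the Bochner (Gidas–Spruck) argument, run with a weight that approximates the
Gaussian. Put `w = u + 1 ≥ 1`, so that negative powers of `w` are harmless and no maximum principle
is needed; the equation becomes `Δw = -w ^ p + r`, where `r` is of lower order
(`abs_add_one_rpow_sub_le`) apart from the drift `lam x · ∇w`.

For a cutoff `φ` and an exponent `m`, four divergences integrate to zero: those of
`φ w ^ (1 - m) (Δw ∇w - D²w ∇w)`, `φ w ^ (-m) |∇w|² ∇w`, `w ^ (1 - m) |∇w|² ∇φ` and
`φ w ^ (1 - m + p) ∇w`. The first one formally involves third derivatives of `w`, which cancel; for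
`w` merely `C²` it rests on the identity `∫ ∂ᵢf ∂ⱼg = ∫ ∂ⱼf ∂ᵢg` for `C¹` functions, `f` compactly
supported (`integral_fderiv_mul_fderiv_comm`).

In a suitable combination of the four, the Hessian disappears by the Cauchy–Schwarz inequality for
the trace of `D²w - m w⁻¹ ∇w ⊗ ∇w` (`trace_sub_sq_le`). What remains is a quadratic form in
`|∇w|² / w` and `w ^ p`, which is negative definite if `0 < m`, `m (n - 2) < n` and
`2 (n - 1) p < (n + 2) (m + 1)`; such an `m ≤ p` exists precisely because `p` is subcritical
(`exists_gidasSpruck_exponent`). Since `m ≤ p`, this form controls `w ^ (p + 1) + |∇w|²`, and all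
the other terms are absorbed pointwise by Young's inequality, at the cost of a power of
`B ∼ (1 + |x|) / τ` bounding `lam |x|` and the logarithmic derivatives of `φ`
(`exists_pointwise_bound`).

The cutoff is `φ = τ ^ N` with `τ = (1 - γ |x|² / N)₊`. It absorbs a fixed power of `1 / τ` and still
leaves `exp (-γ |x|² / 2)`, uniformly in `N` (`cutoff_mul_pow_le`). Hence the integrals of
`φ (w ^ (p + 1) + |∇w|²)` are bounded independently of `N`, and Fatou's lemma as `N → ∞` gives the
claim, because `τ ^ N → exp (-γ |x|²)`.
-/

/-! ### Partial derivatives -/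

/-- The `i`-th partial derivative of a real function on `ℝⁿ`. -/
noncomputable def partialDeriv {n : ℕ} (i : Fin n) (f : EuclideanSpace ℝ (Fin n) → ℝ)
    (x : EuclideanSpace ℝ (Fin n)) : ℝ :=
  fderiv ℝ f x (EuclideanSpace.single i 1)

section PartialDeriv

variable {n : ℕ} {i j : Fin n} {f g : EuclideanSpace ℝ (Fin n) → ℝ}
  {x : EuclideanSpace ℝ (Fin n)}

theorem contDiff_partialDeriv {k l : ℕ∞} (hf : ContDiff ℝ k f) (h : l + 1 ≤ k) :
    ContDiff ℝ l (partialDeriv i f) :=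
  (hf.fderiv_right (by exact_mod_cast h)).clm_apply contDiff_const

theorem continuous_partialDeriv (hf : ContDiff ℝ 1 f) : Continuous (partialDeriv i f) :=
  (hf.continuous_fderiv one_ne_zero).clm_apply continuous_const

theorem HasCompactSupport.partialDeriv (hf : HasCompactSupport f) :
    HasCompactSupport (partialDeriv i f) :=
  hf.fderiv_apply ℝ _

theorem partialDeriv_mul (hf : DifferentiableAt ℝ f x) (hg : DifferentiableAt ℝ g x) :
    partialDeriv i (fun y => f y * g y) x
      = partialDeriv i f x * g x + f x * partialDeriv i g x := by
  simp only [partialDeriv, fderiv_fun_mul hf hg, add_apply, smul_apply, smul_eq_mul]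
  ring

theorem partialDeriv_rpow (hf : DifferentiableAt ℝ f x) (h : 0 < f x) (s : ℝ) :
    partialDeriv i (fun y => f y ^ s) x = s * f x ^ (s - 1) * partialDeriv i f x := by
  simp [partialDeriv, (hf.hasFDerivAt.rpow_const (p := s) (Or.inl h.ne')).fderiv]

theorem partialDeriv_pow (hf : DifferentiableAt ℝ f x) (k : ℕ) :
    partialDeriv i (fun y => f y ^ k) x = k * f x ^ (k - 1) * partialDeriv i f x := by
  simp [partialDeriv, (hf.hasFDerivAt.pow k).fderiv]

theorem partialDeriv_sum {ι : Type*} {s : Finset ι} {F : ι → EuclideanSpace ℝ (Fin n) → ℝ}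
    (hF : ∀ a ∈ s, DifferentiableAt ℝ (F a) x) :
    partialDeriv i (fun y => ∑ a ∈ s, F a y) x = ∑ a ∈ s, partialDeriv i (F a) x := by
  simp [partialDeriv, fderiv_fun_sum hF]

theorem partialDeriv_add_const (c : ℝ) :
    partialDeriv i (fun y => f y + c) = partialDeriv i f := by
  ext x
  simp [partialDeriv]

theorem partialDeriv_partialDeriv (hf : ContDiff ℝ 2 f) :
    partialDeriv i (partialDeriv j f) x
      = fderiv ℝ (fderiv ℝ f) x (EuclideanSpace.single i 1) (EuclideanSpace.single j 1) := by
  have h : DifferentiableAt ℝ (fderiv ℝ f) x :=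
    (hf.fderiv_right (m := 1) (by norm_num)).differentiable one_ne_zero x
  change fderiv ℝ (fun y => fderiv ℝ f y (EuclideanSpace.single j 1)) x _ = _
  rw [fderiv_clm_apply h (differentiableAt_const _)]
  simp

theorem partialDeriv_comm (hf : ContDiff ℝ 2 f) :
    partialDeriv i (partialDeriv j f) x = partialDeriv j (partialDeriv i f) x := by
  rw [partialDeriv_partialDeriv hf, partialDeriv_partialDeriv hf]
  exact (hf.contDiffAt.isSymmSndFDerivAt (by simp)) _ _

theorem laplacian_eq_sum_partialDeriv (hf : ContDiff ℝ 2 f) :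
    Laplacian.laplacian f x = ∑ i, partialDeriv i (partialDeriv i f) x := by
  rw [InnerProductSpace.laplacian_eq_iteratedFDeriv_orthonormalBasis f
    (EuclideanSpace.basisFun (Fin n) ℝ)]
  refine Finset.sum_congr rfl fun i _ => ?_
  rw [partialDeriv_partialDeriv hf, iteratedFDeriv_two_apply]
  simp

theorem gradient_apply_eq_partialDeriv (i : Fin n) : gradient f x i = partialDeriv i f x := by
  have h := inner_gradient_left (𝕜 := ℝ) (f := f) (x := x) (y := EuclideanSpace.single i (1 : ℝ))
  rw [EuclideanSpace.inner_single_right] at h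
  simpa [partialDeriv] using h

theorem norm_gradient_sq : ‖gradient f x‖ ^ 2 = ∑ i, partialDeriv i f x ^ 2 := by
  simp [EuclideanSpace.real_norm_sq_eq, gradient_apply_eq_partialDeriv]

theorem inner_self_gradient :
    inner ℝ x (gradient f x) = ∑ i, x i * partialDeriv i f x := by
  simp only [PiLp.inner_apply, gradient_apply_eq_partialDeriv]
  simp [mul_comm]

end PartialDeriv

/-! ### Compactly supported divergences -/

/-- `F` is integrable on `ℝⁿ` and its integral vanishes. -/
def HasZeroIntegral {n : ℕ} (F : EuclideanSpace ℝ (Fin n) → ℝ) : Prop :=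
  Integrable F volume ∧ ∫ x, F x = 0

namespace HasZeroIntegral

variable {n : ℕ} {F G : EuclideanSpace ℝ (Fin n) → ℝ}

theorem add (hF : HasZeroIntegral F) (hG : HasZeroIntegral G) :
    HasZeroIntegral (fun x => F x + G x) :=
  ⟨hF.1.add hG.1, by rw [integral_add hF.1 hG.1, hF.2, hG.2, add_zero]⟩

theorem const_mul (hF : HasZeroIntegral F) (c : ℝ) : HasZeroIntegral (fun x => c * F x) :=
  ⟨hF.1.const_mul c, by rw [integral_const_mul, hF.2, mul_zero]⟩

theorem sum {ι : Type*} {s : Finset ι} {F : ι → EuclideanSpace ℝ (Fin n) → ℝ}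
    (hF : ∀ a ∈ s, HasZeroIntegral (F a)) : HasZeroIntegral (fun x => ∑ a ∈ s, F a x) :=
  ⟨integrable_finsetSum s fun a ha => (hF a ha).1, by
    rw [integral_finsetSum s fun a ha => (hF a ha).1]
    exact Finset.sum_eq_zero fun a ha => (hF a ha).2⟩

end HasZeroIntegral

section Divergence

variable {n : ℕ} {f g : EuclideanSpace ℝ (Fin n) → ℝ}

theorem hasZeroIntegral_partialDeriv_mul_add (i : Fin n) (hf : ContDiff ℝ 1 f)
    (hg : ContDiff ℝ 1 g) (hc : HasCompactSupport f) :
    HasZeroIntegral (fun x => partialDeriv i f x * g x + f x * partialDeriv i g x) := by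
  have h1 : Integrable (fun x => partialDeriv i f x * g x) volume :=
    ((continuous_partialDeriv hf).mul hg.continuous).integrable_of_hasCompactSupport
      hc.partialDeriv.mul_right
  have h2 : Integrable (fun x => f x * partialDeriv i g x) volume :=
    (hf.continuous.mul (continuous_partialDeriv hg)).integrable_of_hasCompactSupport hc.mul_right
  have h3 : Integrable (fun x => f x * g x) volume :=
    (hf.continuous.mul hg.continuous).integrable_of_hasCompactSupport hc.mul_right
  refine ⟨h1.add h2, ?_⟩
  rw [integral_add h1 h2]
  have := integral_mul_fderiv_eq_neg_fderiv_mul_of_integrable (μ := volume) h1 h2 h3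
    (fun x _ => hf.differentiable one_ne_zero x) (fun x _ => hg.differentiable one_ne_zero x)
  simp only [partialDeriv] at this ⊢
  rw [this, add_neg_cancel]

open scoped Convolution in
/-- Both sides are, up to sign, mixed second derivatives of the convolution of `g` with the
reflection of `f`, which is twice differentiable although `f` and `g` are only `C¹`. -/
theorem integral_fderiv_mul_fderiv_comm {E : Type*} [NormedAddCommGroup E] [NormedSpace ℝ E]
    [FiniteDimensional ℝ E] [MeasurableSpace E] [BorelSpace E] {μ : Measure E}
    [μ.IsAddHaarMeasure] {f g : E → ℝ} (hf : ContDiff ℝ 1 f)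
    (hg : ContDiff ℝ 1 g) (hcf : HasCompactSupport f) (hcg : HasCompactSupport g) (a b : E) :
    ∫ x, fderiv ℝ f x a * fderiv ℝ g x b ∂μ = ∫ x, fderiv ℝ f x b * fderiv ℝ g x a ∂μ := by
  set F : E → ℝ := fun x => f (-x) with hF
  have hFd : ContDiff ℝ 1 F := hf.comp contDiff_neg
  have hFc : HasCompactSupport F := hcf.comp_homeomorph (Homeomorph.neg E)
  have hF' : ∀ x v, fderiv ℝ F x v = - fderiv ℝ f (-x) v := by
    intro x v
    have h := (hf.differentiable one_ne_zero (-x)).hasFDerivAt.comp x (hasFDerivAt_id x).neg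
    have h' : HasFDerivAt F _ x := h
    rw [h'.fderiv]
    simp
  have hgi : LocallyIntegrable g μ := hg.continuous.locallyIntegrable
  have h1 : ∀ y, HasFDerivAt (g ⋆[ContinuousLinearMap.mul ℝ ℝ, μ] F)
      ((g ⋆[(ContinuousLinearMap.mul ℝ ℝ).precompR E, μ] fderiv ℝ F) y) y := fun y =>
    hFc.hasFDerivAt_convolution_right _ hgi hFd y
  have hF'i : LocallyIntegrable (fderiv ℝ F) μ :=
    (hFd.continuous_fderiv one_ne_zero).locallyIntegrable
  have h2 := hcg.hasFDerivAt_convolution_left ((ContinuousLinearMap.mul ℝ ℝ).precompR E)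
    hg hF'i (0 : E)
  have key := second_derivative_symmetric h1 h2 a b
  have ev : ∀ v u : E, (convolution (𝕜 := ℝ) (fderiv ℝ g) (fderiv ℝ F)
      (((ContinuousLinearMap.mul ℝ ℝ).precompR E).precompL E) μ : E → E →L[ℝ] E →L[ℝ] ℝ) 0 v u
        = - ∫ x, fderiv ℝ g x v * fderiv ℝ f x u ∂μ := by
    intro v u
    have hi := (hcg.fderiv ℝ).convolutionExists_left (𝕜 := ℝ) (F := E →L[ℝ] E →L[ℝ] ℝ)
      (((ContinuousLinearMap.mul ℝ ℝ).precompR E).precompL E) (hg.continuous_fderiv one_ne_zero)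
      hF'i 0
    rw [convolution, ContinuousLinearMap.integral_apply hi.integrable,
      ContinuousLinearMap.integral_apply (hi.integrable.apply_continuousLinearMap v), ← integral_neg]
    refine integral_congr_ae (Filter.Eventually.of_forall fun t => ?_)
    simp [ContinuousLinearMap.precompL_apply, ContinuousLinearMap.precompR_apply, hF']
  rw [ev, ev, neg_inj] at key
  simp_rw [mul_comm (fderiv ℝ g _ _)] at key
  exact key.symm

theorem hasZeroIntegral_partialDeriv_mul_sub (i j : Fin n) (hf : ContDiff ℝ 1 f)
    (hg : ContDiff ℝ 1 g) (hc : HasCompactSupport f) :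
    HasZeroIntegral (fun x => partialDeriv i f x * partialDeriv j g x
      - partialDeriv j f x * partialDeriv i g x) := by
  have hI : ∀ i j : Fin n, Integrable (fun x => partialDeriv i f x * partialDeriv j g x) volume :=
    fun i j => ((continuous_partialDeriv hf).mul
      (continuous_partialDeriv hg)).integrable_of_hasCompactSupport hc.partialDeriv.mul_right
  refine ⟨(hI i j).sub (hI j i), ?_⟩
  rw [integral_sub (hI i j) (hI j i), sub_eq_zero]
  -- Cut `g` off outside a ball containing the support of `f`.
  obtain ⟨R, hR⟩ := hc.isCompact.isBounded.subset_ball (0 : EuclideanSpace ℝ (Fin n))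
  have hR' : (0 : ℝ) < max R 1 := lt_max_of_lt_right one_pos
  let χ : ContDiffBump (0 : EuclideanSpace ℝ (Fin n)) := ⟨max R 1, max R 1 + 1, hR', by linarith⟩
  have hG : ContDiff ℝ 1 (fun x => χ x * g x) := χ.contDiff.mul hg
  have hGc : HasCompactSupport (fun x => χ x * g x) := χ.hasCompactSupport.mul_right
  have hfd : ∀ (x : EuclideanSpace ℝ (Fin n)) (v v' : EuclideanSpace ℝ (Fin n)),
      fderiv ℝ f x v * fderiv ℝ (fun x => χ x * g x) x v' = fderiv ℝ f x v * fderiv ℝ g x v' := by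
    intro x v v'
    by_cases hx : x ∈ tsupport f
    · have : (fun x => χ x * g x) =ᶠ[nhds x] g := by
        have hx' : x ∈ Metric.ball (0 : EuclideanSpace ℝ (Fin n)) (max R 1) :=
          Metric.ball_subset_ball (le_max_left _ _) (hR hx)
        filter_upwards [Metric.isOpen_ball.mem_nhds hx'] with y hy
        rw [χ.one_of_mem_closedBall (Metric.ball_subset_closedBall hy), one_mul]
      rw [this.fderiv_eq]
    · have : fderiv ℝ f x = 0 := by
        by_contra h
        exact hx (support_fderiv_subset ℝ h)
      simp [this]
  have := integral_fderiv_mul_fderiv_comm (μ := volume) hf hG hc hGc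
    (EuclideanSpace.single i 1) (EuclideanSpace.single j 1)
  simp_rw [hfd] at this
  exact this

end Divergence

/-! ### Integral identities for a positive function and a cutoff -/

section Identities

variable {n : ℕ} {w φ : EuclideanSpace ℝ (Fin n) → ℝ}

theorem contDiff_sum_sq_partialDeriv (hw : ContDiff ℝ 2 w) :
    ContDiff ℝ 1 (fun x => ∑ i, partialDeriv i w x ^ 2) :=
  ContDiff.sum fun _ _ => (contDiff_partialDeriv (k := 2) (l := 1) hw (by norm_num)).pow 2

theorem partialDeriv_sum_sq_partialDeriv (hw : ContDiff ℝ 2 w) (i : Fin n)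
    (x : EuclideanSpace ℝ (Fin n)) :
    partialDeriv i (fun y => ∑ j, partialDeriv j w y ^ 2) x
      = 2 * ∑ j, partialDeriv j w x * partialDeriv i (partialDeriv j w) x := by
  have hd : ∀ j, Differentiable ℝ (partialDeriv j w) := fun j =>
    (contDiff_partialDeriv (k := 2) (l := 1) hw (by norm_num)).differentiable one_ne_zero
  rw [partialDeriv_sum (F := fun j y => partialDeriv j w y ^ 2) fun j _ => (hd j x).pow 2,
    Finset.mul_sum]
  refine Finset.sum_congr rfl fun j _ => ?_
  rw [partialDeriv_pow (hd j x)]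
  push_cast
  ring

/-- The integrated Bochner identity: the divergence of `φ w ^ k (Δw ∇w - D²w ∇w)`, in which the
third derivatives of `w` cancel, integrates to zero. Only `C²` regularity is needed. -/
theorem hasZeroIntegral_bochner (hw : ContDiff ℝ 2 w) (hpos : ∀ x, 0 < w x) (hφ : ContDiff ℝ 2 φ)
    (hc : HasCompactSupport φ) (k : ℝ) :
    HasZeroIntegral (fun x =>
      w x ^ k * (∑ i, partialDeriv i φ x * partialDeriv i w x)
          * (∑ i, partialDeriv i (partialDeriv i w) x)
        + k * φ x * w x ^ (k - 1) * (∑ i, partialDeriv i w x ^ 2)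
          * (∑ i, partialDeriv i (partialDeriv i w) x)
        + φ x * w x ^ k * (∑ i, partialDeriv i (partialDeriv i w) x) ^ 2
        - w x ^ k * (∑ i, ∑ j, partialDeriv i φ x * partialDeriv j w x
            * partialDeriv i (partialDeriv j w) x)
        - k * φ x * w x ^ (k - 1) * (∑ i, ∑ j, partialDeriv i w x * partialDeriv j w x
            * partialDeriv i (partialDeriv j w) x)
        - φ x * w x ^ k * (∑ i, ∑ j, partialDeriv i (partialDeriv j w) x ^ 2)) := by
  have hP : ∀ j, ContDiff ℝ 1 (partialDeriv j w) := fun j =>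
    contDiff_partialDeriv (k := 2) (l := 1) hw (by norm_num)
  have hw1 : ContDiff ℝ 1 w := hw.of_le (by norm_num)
  have hφ1 : ContDiff ℝ 1 φ := hφ.of_le (by norm_num)
  have hwk : ContDiff ℝ 1 (fun x => w x ^ k) := hw1.rpow_const_of_ne fun x => (hpos x).ne'
  have key := HasZeroIntegral.sum (s := Finset.univ) fun i _ =>
    HasZeroIntegral.sum (s := Finset.univ) fun j _ =>
      hasZeroIntegral_partialDeriv_mul_sub (n := n) j i (f := fun x => φ x * w x ^ k *
        partialDeriv j w x) (g := partialDeriv i w) ((hφ1.mul hwk).mul (hP j)) (hP i)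
        hc.mul_right.mul_right
  convert key using 1
  funext x
  have d0 : ∀ i, partialDeriv i (fun x => φ x * w x ^ k) x
      = partialDeriv i φ x * w x ^ k + φ x * (k * w x ^ (k - 1) * partialDeriv i w x) := by
    intro i
    rw [partialDeriv_mul (hφ1.differentiable one_ne_zero x) (hwk.differentiable one_ne_zero x),
      partialDeriv_rpow (hw1.differentiable one_ne_zero x) (hpos x)]
  have d1 : ∀ i j, partialDeriv i (fun x => φ x * w x ^ k * partialDeriv j w x) x
      = (partialDeriv i φ x * w x ^ k + φ x * (k * w x ^ (k - 1) * partialDeriv i w x))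
          * partialDeriv j w x + φ x * w x ^ k * partialDeriv i (partialDeriv j w) x := by
    intro i j
    rw [partialDeriv_mul ((hφ1.mul hwk).differentiable one_ne_zero x)
      ((hP j).differentiable one_ne_zero x), d0]
  have e : ∀ i j : Fin n, partialDeriv j (fun x => φ x * w x ^ k * partialDeriv j w x) x
          * partialDeriv i (partialDeriv i w) x
        - partialDeriv i (fun x => φ x * w x ^ k * partialDeriv j w x) x
          * partialDeriv j (partialDeriv i w) x
      = w x ^ k * (partialDeriv i (partialDeriv i w) x * (partialDeriv j φ x * partialDeriv j w x))
        + k * φ x * w x ^ (k - 1)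
          * (partialDeriv i (partialDeriv i w) x * partialDeriv j w x ^ 2)
        + φ x * w x ^ k
          * (partialDeriv i (partialDeriv i w) x * partialDeriv j (partialDeriv j w) x)
        - w x ^ k * (partialDeriv i φ x * partialDeriv j w x * partialDeriv i (partialDeriv j w) x)
        - k * φ x * w x ^ (k - 1)
          * (partialDeriv i w x * partialDeriv j w x * partialDeriv i (partialDeriv j w) x)
        - φ x * w x ^ k * partialDeriv i (partialDeriv j w) x ^ 2 := by
    intro i j
    rw [d1, d1, partialDeriv_comm hw (i := j) (j := i)]
    ring
  simp only [e, Finset.sum_add_distrib, Finset.sum_sub_distrib, ← Finset.mul_sum,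
    ← Finset.sum_mul]
  ring

/-- The divergence of `φ w ^ l |∇w|² ∇w` integrates to zero. -/
theorem hasZeroIntegral_div_sq_smul_gradient (hw : ContDiff ℝ 2 w) (hpos : ∀ x, 0 < w x)
    (hφ : ContDiff ℝ 2 φ) (hc : HasCompactSupport φ) (l : ℝ) :
    HasZeroIntegral (fun x =>
      w x ^ l * (∑ i, partialDeriv i w x ^ 2) * (∑ i, partialDeriv i φ x * partialDeriv i w x)
        + l * φ x * w x ^ (l - 1) * (∑ i, partialDeriv i w x ^ 2) ^ 2
        + 2 * φ x * w x ^ l * (∑ i, ∑ j, partialDeriv i w x * partialDeriv j w x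
            * partialDeriv i (partialDeriv j w) x)
        + φ x * w x ^ l * (∑ i, partialDeriv i w x ^ 2)
          * (∑ i, partialDeriv i (partialDeriv i w) x)) := by
  have hP : ∀ j, ContDiff ℝ 1 (partialDeriv j w) := fun j =>
    contDiff_partialDeriv (k := 2) (l := 1) hw (by norm_num)
  have hw1 : ContDiff ℝ 1 w := hw.of_le (by norm_num)
  have hφ1 : ContDiff ℝ 1 φ := hφ.of_le (by norm_num)
  have hwk : ContDiff ℝ 1 (fun x => w x ^ l) := hw1.rpow_const_of_ne fun x => (hpos x).ne'
  have hS := contDiff_sum_sq_partialDeriv hw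
  have key := HasZeroIntegral.sum (s := Finset.univ) fun i _ =>
    hasZeroIntegral_partialDeriv_mul_add (n := n) i (f := fun x => φ x * w x ^ l *
      ∑ j, partialDeriv j w x ^ 2) (g := partialDeriv i w) ((hφ1.mul hwk).mul hS) (hP i)
      hc.mul_right.mul_right
  convert key using 1
  funext x
  have e : ∀ i : Fin n,
      partialDeriv i (fun x => φ x * w x ^ l * ∑ j, partialDeriv j w x ^ 2) x * partialDeriv i w x
        + φ x * w x ^ l * (∑ j, partialDeriv j w x ^ 2) * partialDeriv i (partialDeriv i w) x
      = w x ^ l * (∑ j, partialDeriv j w x ^ 2) * (partialDeriv i φ x * partialDeriv i w x)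
        + l * φ x * w x ^ (l - 1) * (∑ j, partialDeriv j w x ^ 2) * partialDeriv i w x ^ 2
        + 2 * φ x * w x ^ l * (∑ j, partialDeriv i w x * partialDeriv j w x
            * partialDeriv i (partialDeriv j w) x)
        + φ x * w x ^ l * (∑ j, partialDeriv j w x ^ 2)
          * partialDeriv i (partialDeriv i w) x := by
    intro i
    rw [partialDeriv_mul ((hφ1.mul hwk).differentiable one_ne_zero x)
      (hS.differentiable one_ne_zero x), partialDeriv_mul (hφ1.differentiable one_ne_zero x)
      (hwk.differentiable one_ne_zero x), partialDeriv_rpow (hw1.differentiable one_ne_zero x)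
      (hpos x), partialDeriv_sum_sq_partialDeriv hw]
    simp_rw [mul_assoc (partialDeriv i w x), ← Finset.mul_sum]
    ring
  simp only [e, Finset.sum_add_distrib, ← Finset.mul_sum]
  ring

/-- The divergence of `w ^ k |∇w|² ∇φ` integrates to zero. -/
theorem hasZeroIntegral_div_sq_smul_gradient_cutoff (hw : ContDiff ℝ 2 w) (hpos : ∀ x, 0 < w x)
    (hφ : ContDiff ℝ 2 φ) (hc : HasCompactSupport φ) (k : ℝ) :
    HasZeroIntegral (fun x =>
      w x ^ k * (∑ i, partialDeriv i w x ^ 2) * (∑ i, partialDeriv i (partialDeriv i φ) x)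
        + k * w x ^ (k - 1) * (∑ i, partialDeriv i w x ^ 2)
          * (∑ i, partialDeriv i φ x * partialDeriv i w x)
        + 2 * w x ^ k * (∑ i, ∑ j, partialDeriv i φ x * partialDeriv j w x
            * partialDeriv i (partialDeriv j w) x)) := by
  have hw1 : ContDiff ℝ 1 w := hw.of_le (by norm_num)
  have hwk : ContDiff ℝ 1 (fun x => w x ^ k) := hw1.rpow_const_of_ne fun x => (hpos x).ne'
  have hS := contDiff_sum_sq_partialDeriv hw
  have key := HasZeroIntegral.sum (s := Finset.univ) fun i _ =>
    hasZeroIntegral_partialDeriv_mul_add (n := n) i (f := partialDeriv i φ)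
      (g := fun x => w x ^ k * ∑ j, partialDeriv j w x ^ 2)
      (contDiff_partialDeriv (k := 2) (l := 1) hφ (by norm_num)) (hwk.mul hS) hc.partialDeriv
  convert key using 1
  funext x
  have e : ∀ i : Fin n,
      partialDeriv i (partialDeriv i φ) x * (w x ^ k * ∑ j, partialDeriv j w x ^ 2)
        + partialDeriv i φ x * partialDeriv i (fun x => w x ^ k * ∑ j, partialDeriv j w x ^ 2) x
      = w x ^ k * (∑ j, partialDeriv j w x ^ 2) * partialDeriv i (partialDeriv i φ) x
        + k * w x ^ (k - 1) * (∑ j, partialDeriv j w x ^ 2)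
          * (partialDeriv i φ x * partialDeriv i w x)
        + 2 * w x ^ k * (∑ j, partialDeriv i φ x * partialDeriv j w x
            * partialDeriv i (partialDeriv j w) x) := by
    intro i
    rw [partialDeriv_mul (hwk.differentiable one_ne_zero x)
      (hS.differentiable one_ne_zero x), partialDeriv_rpow (hw1.differentiable one_ne_zero x)
      (hpos x), partialDeriv_sum_sq_partialDeriv hw]
    simp_rw [mul_assoc (partialDeriv i φ x), ← Finset.mul_sum]
    ring
  simp only [e, Finset.sum_add_distrib, ← Finset.mul_sum]

/-- The divergence of `φ w ^ l ∇w` integrates to zero. -/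
theorem hasZeroIntegral_div_smul_gradient (hw : ContDiff ℝ 2 w) (hpos : ∀ x, 0 < w x)
    (hφ : ContDiff ℝ 2 φ) (hc : HasCompactSupport φ) (l : ℝ) :
    HasZeroIntegral (fun x =>
      w x ^ l * (∑ i, partialDeriv i φ x * partialDeriv i w x)
        + l * φ x * w x ^ (l - 1) * (∑ i, partialDeriv i w x ^ 2)
        + φ x * w x ^ l * (∑ i, partialDeriv i (partialDeriv i w) x)) := by
  have hP : ∀ j, ContDiff ℝ 1 (partialDeriv j w) := fun j =>
    contDiff_partialDeriv (k := 2) (l := 1) hw (by norm_num)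
  have hw1 : ContDiff ℝ 1 w := hw.of_le (by norm_num)
  have hφ1 : ContDiff ℝ 1 φ := hφ.of_le (by norm_num)
  have hwk : ContDiff ℝ 1 (fun x => w x ^ l) := hw1.rpow_const_of_ne fun x => (hpos x).ne'
  have key := HasZeroIntegral.sum (s := Finset.univ) fun i _ =>
    hasZeroIntegral_partialDeriv_mul_add (n := n) i (f := fun x => φ x * w x ^ l)
      (g := partialDeriv i w) (hφ1.mul hwk) (hP i) hc.mul_right
  convert key using 1
  funext x
  have e : ∀ i : Fin n,
      partialDeriv i (fun x => φ x * w x ^ l) x * partialDeriv i w x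
        + φ x * w x ^ l * partialDeriv i (partialDeriv i w) x
      = w x ^ l * (partialDeriv i φ x * partialDeriv i w x)
        + l * φ x * w x ^ (l - 1) * partialDeriv i w x ^ 2
        + φ x * w x ^ l * partialDeriv i (partialDeriv i w) x := by
    intro i
    rw [partialDeriv_mul (hφ1.differentiable one_ne_zero x)
      (hwk.differentiable one_ne_zero x), partialDeriv_rpow (hw1.differentiable one_ne_zero x)
      (hpos x)]
    ring
  simp only [e, Finset.sum_add_distrib, ← Finset.mul_sum]

end Identities

/-! ### The pointwise inequality -/

/-- Young's inequality with a power of a parameter `B`. -/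
theorem exists_pow_mul_rpow_le {a b ε : ℝ} (hab : a < b) (hε : 0 < ε) (k : ℕ) :
    ∃ C : ℝ, ∃ Q : ℕ, 0 ≤ C ∧ ∀ w B : ℝ, 1 ≤ w → 1 ≤ B →
      B ^ k * w ^ a ≤ ε * w ^ b + C * B ^ Q := by
  have hba : 0 < b - a := sub_pos.2 hab
  set t : ℝ := |a| / (b - a) with ht
  have ht0 : 0 ≤ t := div_nonneg (abs_nonneg a) hba.le
  refine ⟨(1 / ε) ^ t, k + ⌈k * t⌉₊, by positivity, fun w B hw hB => ?_⟩
  have hw0 : 0 < w := one_pos.trans_le hw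
  have hB0 : 0 < B := one_pos.trans_le hB
  rcases le_total (B ^ k) (ε * w ^ (b - a)) with h | h
  · calc B ^ k * w ^ a ≤ ε * w ^ (b - a) * w ^ a := by gcongr
      _ = ε * w ^ b := by rw [mul_assoc, ← Real.rpow_add hw0, sub_add_cancel]
      _ ≤ _ := le_add_of_nonneg_right (by positivity)
  · have h1 : w ^ (b - a) ≤ 1 / ε * B ^ k := by
      rw [one_div, ← div_eq_inv_mul, le_div_iff₀ hε, mul_comm]
      exact h
    have h2 : w ^ a ≤ (1 / ε) ^ t * B ^ (k * t) := by
      calc w ^ a ≤ w ^ |a| := Real.rpow_le_rpow_of_exponent_le hw (le_abs_self a)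
        _ = (w ^ (b - a)) ^ t := by
          rw [← Real.rpow_mul hw0.le, ht, mul_div_cancel₀ _ hba.ne']
        _ ≤ (1 / ε * B ^ k) ^ t := by gcongr
        _ = (1 / ε) ^ t * B ^ (k * t) := by
          rw [Real.mul_rpow (by positivity) (by positivity), Real.rpow_mul hB0.le,
            Real.rpow_natCast]
    have h3 : B ^ (k * t) ≤ B ^ ⌈k * t⌉₊ := by
      rw [← Real.rpow_natCast]
      exact Real.rpow_le_rpow_of_exponent_le hB (Nat.le_ceil _)
    calc B ^ k * w ^ a ≤ B ^ k * ((1 / ε) ^ t * B ^ ⌈k * t⌉₊) := by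
          gcongr
          exact h2.trans (by gcongr)
      _ = (1 / ε) ^ t * B ^ (k + ⌈k * t⌉₊) := by rw [pow_add]; ring
      _ ≤ _ := le_add_of_nonneg_left (by positivity)

theorem exists_const_mul_pow_mul_rpow_le {a b ε K : ℝ} (hab : a < b) (hε : 0 < ε) (hK : 0 ≤ K)
    (k : ℕ) : ∃ C : ℝ, ∃ Q : ℕ, 0 ≤ C ∧ ∀ w B : ℝ, 1 ≤ w → 1 ≤ B →
      K * (B ^ k * w ^ a) ≤ ε * w ^ b + C * B ^ Q := by
  obtain ⟨C, Q, hC0, hC⟩ := exists_pow_mul_rpow_le hab (ε := ε / (K + 1)) (by positivity) k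
  refine ⟨K * C, Q, by positivity, fun w B hw hB => ?_⟩
  have h : K * (ε / (K + 1)) ≤ ε := by
    rw [← mul_div_assoc, div_le_iff₀ (by positivity)]
    linarith
  have hw0 : 0 < w := one_pos.trans_le hw
  calc K * (B ^ k * w ^ a) ≤ K * (ε / (K + 1) * w ^ b + C * B ^ Q) := by gcongr; exact hC w B hw hB
    _ = K * (ε / (K + 1)) * w ^ b + K * C * B ^ Q := by ring
    _ ≤ _ := by gcongr

/-- The quadratic form in `q = w ^ p` and `a = |∇w|² / w` left by the Bochner identity is negative
definite, up to the square of an error `e`. -/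
theorem exists_quadratic_bound {c₁ c₂ c₃ : ℝ} (h₁ : 0 < c₁) (h₃ : 0 < c₃) (ν b D : ℝ)
    (hν : 0 ≤ ν) (hν' : ν ≤ 1) :
    ∃ K : ℝ, 0 ≤ K ∧ ∀ q a e r G Z : ℝ, 0 ≤ q → 0 ≤ a → 0 ≤ e → |r| ≤ e → |G| ≤ e → Z ≤ e ^ 2 →
      -c₁ * q ^ 2 - c₂ * (a * q) - c₃ * a ^ 2 - 2 * ν * (q * r) + ν * r ^ 2 + b * (a * r)
        + G * (-q + r) + a * G + Z / 2 + D * (q * (G + r))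
      ≤ -(3 / 4 * c₁) * q ^ 2 - c₂ * (a * q) - 3 / 4 * c₃ * a ^ 2 + K * e ^ 2 := by
  set M : ℝ := 3 + |b| + 2 * |D| with hM
  have hb := abs_nonneg b
  have hD := abs_nonneg D
  refine ⟨M ^ 2 / c₁ + M ^ 2 / c₃ + 3, by positivity, ?_⟩
  intro q a e r G Z hq ha he hr hG hZ
  have e1 : -2 * ν * (q * r) ≤ 2 * (q * e) := by
    have : |ν * (q * r)| ≤ q * e := by
      rw [abs_mul, abs_mul, abs_of_nonneg hν, abs_of_nonneg hq]
      calc ν * (q * |r|) ≤ 1 * (q * e) := by gcongr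
        _ = q * e := one_mul _
    linarith [neg_abs_le (ν * (q * r))]
  have e2 : ν * r ^ 2 ≤ e ^ 2 := by
    calc ν * r ^ 2 ≤ 1 * e ^ 2 := mul_le_mul hν' (sq_le_sq' (by linarith [neg_abs_le r])
          ((le_abs_self r).trans hr)) (sq_nonneg r) zero_le_one
      _ = e ^ 2 := one_mul _
  have e3 : b * (a * r) ≤ |b| * (a * e) := by
    refine (le_abs_self _).trans ?_
    rw [abs_mul, abs_mul, abs_of_nonneg ha]
    gcongr
  have e4 : G * (-q + r) ≤ q * e + e ^ 2 := by
    have h1 : -(G * q) ≤ q * e := by nlinarith [neg_abs_le G]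
    have h2 : G * r ≤ e ^ 2 := by
      refine (le_abs_self _).trans ?_
      rw [abs_mul, sq]
      gcongr
    linarith
  have e5 : a * G ≤ a * e := mul_le_mul_of_nonneg_left ((le_abs_self G).trans hG) ha
  have e6 : D * (q * (G + r)) ≤ 2 * |D| * (q * e) := by
    refine (le_abs_self _).trans ?_
    rw [abs_mul, abs_mul, abs_of_nonneg hq]
    have : |G + r| ≤ 2 * e := (abs_add_le G r).trans (by linarith)
    calc |D| * (q * |G + r|) ≤ |D| * (q * (2 * e)) := by gcongr
      _ = _ := by ring
  have e7 : M * (q * e) ≤ c₁ / 4 * q ^ 2 + M ^ 2 / c₁ * e ^ 2 := by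
    have : c₁ / 4 * q ^ 2 + M ^ 2 / c₁ * e ^ 2 - M * (q * e)
        = (c₁ * q / 2 - M * e) ^ 2 / c₁ := by
      field_simp
      ring
    have := div_nonneg (sq_nonneg (c₁ * q / 2 - M * e)) h₁.le
    linarith
  have e8 : M * (a * e) ≤ c₃ / 4 * a ^ 2 + M ^ 2 / c₃ * e ^ 2 := by
    have : c₃ / 4 * a ^ 2 + M ^ 2 / c₃ * e ^ 2 - M * (a * e)
        = (c₃ * a / 2 - M * e) ^ 2 / c₃ := by
      field_simp
      ring
    have := div_nonneg (sq_nonneg (c₃ * a / 2 - M * e)) h₃.le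
    linarith
  have e9 : (3 + 2 * |D|) * (q * e) ≤ M * (q * e) := by
    have := mul_nonneg hb (mul_nonneg hq he)
    rw [hM]; linarith
  have e10 : (1 + |b|) * (a * e) ≤ M * (a * e) := by
    have h1 := mul_nonneg hD (mul_nonneg ha he)
    have h2 := mul_nonneg ha he
    rw [hM]; linarith
  have := sq_nonneg e
  linarith

/-- The part of the four divergences that remains after completing the square in the Hessian;
`v`, `W`, `q` stand for `w⁻¹`, `w ^ (1 - m)`, `w ^ p`. -/
theorem bochner_combination (W v S q r G d hg hP HH m p ν c₁ : ℝ) :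
    W * (-c₁ * q ^ 2
        - (1 - m + (1 + m) / 2 + 2 * m * (1 - ν) - (ν + c₁) * (1 - m + p)) * (S * v * q)
        - ((1 + m) / 2 * m - m ^ 2 * ν) * (S * v) ^ 2 - 2 * ν * (q * r) + ν * r ^ 2
        + (1 - m + (1 + m) / 2 + 2 * m * (1 - ν)) * (S * v * r) + G * (-q + r) + S * v * G
        + S * d / 2 + (ν + c₁) * (q * (G + r)))
      - ((W * G * (r - q) + (1 - m) * (W * v) * S * (r - q) + W * (r - q) ^ 2
          - W * hg - (1 - m) * (W * v) * hP - W * HH)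
        + (1 + m) / 2 * (W * v * S * G + (1 - m - 1) * (W * v * v) * S ^ 2
          + 2 * (W * v) * hP + W * v * S * (r - q))
        + 1 / 2 * (W * S * d + (1 - m) * (W * v) * S * G + 2 * W * hg)
        + (ν + c₁) * (W * q * G + (1 - m + p) * (W * q * v) * S + W * q * (r - q)))
      = W * (HH - 2 * m * (hP * v) + m ^ 2 * (S * v) ^ 2
          - (1 - ν) * (r - q - m * (S * v)) ^ 2) := by
  ring

set_option maxHeartbeats 1000000 in
/-- The pointwise inequality behind the energy estimate, for `w ≥ 1`. Here `S`, `T`, `HH`, `hP`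
stand for `|∇w|²`, `Δw`, `|D²w|²`, `D²w(∇w, ∇w)`, and `G`, `d`, `hg` for `∇φ·∇w`, `Δφ`,
`D²w(∇φ, ∇w)` divided by the cutoff `φ`. The left side combines the four divergences whose integrals
vanish, so that `hg` and `hP` cancel once `hH`, the Cauchy–Schwarz inequality for the trace of
`D²w - m w⁻¹ ∇w ⊗ ∇w`, is used. The conditions on `m` make the coefficients of `|∇w|⁴ / w²` and of
`w ^ p |∇w|² / w` negative. -/
theorem exists_pointwise_bound {n : ℕ} (hn : 2 ≤ n) {p m C₀ σ : ℝ} (hp : 1 < p) (hm0 : 0 < m)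
    (hmp : m ≤ p) (hm1 : m * (n - 2) < n) (hm2 : 2 * (n - 1) * p < (n + 2) * (m + 1))
    (hσ : σ < p) (hC₀ : 0 ≤ C₀) :
    ∃ D c C : ℝ, ∃ Q : ℕ, 0 < c ∧ 0 ≤ C ∧ ∀ w S y B G d T hg hP HH : ℝ, 1 ≤ w → 0 ≤ y →
      S = y ^ 2 → 1 ≤ B → |G| ≤ B * y → |d| ≤ B ^ 2 → |T + w ^ p| ≤ B * y + C₀ * w ^ σ →
      (hH : 1 / (n : ℝ) * (T - m * (S / w)) ^ 2 ≤ HH - 2 * m * (hP / w) + m ^ 2 * (S / w) ^ 2) →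
      (w ^ (1 - m) * G * T + (1 - m) * w ^ (1 - m - 1) * S * T + w ^ (1 - m) * T ^ 2
          - w ^ (1 - m) * hg - (1 - m) * w ^ (1 - m - 1) * hP - w ^ (1 - m) * HH)
        + (1 + m) / 2 * (w ^ (1 - m - 1) * S * G + (1 - m - 1) * w ^ (1 - m - 1 - 1) * S ^ 2
          + 2 * w ^ (1 - m - 1) * hP + w ^ (1 - m - 1) * S * T)
        + 1 / 2 * (w ^ (1 - m) * S * d + (1 - m) * w ^ (1 - m - 1) * S * G
          + 2 * w ^ (1 - m) * hg)
        + D * (w ^ (1 - m + p) * G + (1 - m + p) * w ^ (1 - m + p - 1) * S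
          + w ^ (1 - m + p) * T)
      ≤ -c * (w ^ (p + 1) + S) + C * B ^ Q := by
  have hn2 : (2 : ℝ) ≤ n := by exact_mod_cast hn
  have hn0 : (0 : ℝ) < n := by linarith
  have hkp : 0 < 1 - m + p := by linarith
  -- `α` and `δ` are the Gidas–Spruck coefficients; `D` exceeds `1 - 1 / n` slightly, so that the
  -- last divergence absorbs `∫ φ w ^ (2 p + 1 - m)` at the expense of half of `δ`.
  obtain ⟨ν, hν⟩ : ∃ ν : ℝ, ν = 1 - 1 / n := ⟨_, rfl⟩
  obtain ⟨b, hb⟩ : ∃ b : ℝ, b = (3 - m) / 2 + 2 * m / n := ⟨_, rfl⟩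
  obtain ⟨α, hα⟩ : ∃ α : ℝ, α = m * (n - m * (n - 2)) / (2 * n) := ⟨_, rfl⟩
  obtain ⟨δ, hδ⟩ : ∃ δ : ℝ, δ = ((n + 2) * (m + 1) - 2 * (n - 1) * p) / (2 * n) := ⟨_, rfl⟩
  obtain ⟨c₁, hc₁⟩ : ∃ c₁ : ℝ, c₁ = δ / (2 * (1 - m + p)) := ⟨_, rfl⟩
  have hα0 : 0 < α := by rw [hα]; exact div_pos (mul_pos hm0 (by linarith)) (by linarith)
  have hδ0 : 0 < δ := by rw [hδ]; exact div_pos (by linarith) (by linarith)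
  have hc₁0 : 0 < c₁ := by rw [hc₁]; positivity
  have hν0 : 0 ≤ ν := by
    rw [hν, sub_nonneg, div_le_one hn0]; linarith
  have hν1 : ν ≤ 1 := by rw [hν]; linarith [div_pos one_pos hn0]
  obtain ⟨D, hD⟩ : ∃ D : ℝ, D = ν + c₁ := ⟨_, rfl⟩
  have hbD : b - D * (1 - m + p) = δ / 2 := by
    have : c₁ * (1 - m + p) = δ / 2 := by rw [hc₁]; field_simp
    rw [hD, add_mul, this, hν, hb, hδ]
    field_simp
    ring
  obtain ⟨K, hK0, hK⟩ := exists_quadratic_bound (c₂ := δ / 2) hc₁0 hα0 ν b D hν0 hν1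
  -- The error is `e² ≤ 2 B² |∇w|² + 2 C₀² w ^ (2 σ)`.
  obtain ⟨K₁, hK₁⟩ : ∃ K₁ : ℝ, K₁ = (2 * K) ^ 2 / α := ⟨_, rfl⟩
  obtain ⟨K₂, hK₂⟩ : ∃ K₂ : ℝ, K₂ = 2 * K * C₀ ^ 2 := ⟨_, rfl⟩
  have hK₁0 : 0 ≤ K₁ := by rw [hK₁]; positivity
  have hK₂0 : 0 ≤ K₂ := by rw [hK₂]; positivity
  obtain ⟨C₃, Q₃, hC₃0, hC₃⟩ := exists_const_mul_pow_mul_rpow_le (a := 1 - m + 2)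
    (b := 1 - m + 2 * p) (ε := c₁ / 4) (by linarith) (by positivity) hK₁0 4
  obtain ⟨C₄, Q₄, hC₄0, hC₄⟩ := exists_const_mul_pow_mul_rpow_le (a := 1 - m + 2 * σ)
    (b := 1 - m + 2 * p) (ε := c₁ / 4) (by linarith) (by positivity) hK₂0 0
  refine ⟨D, min (c₁ / 4) (δ / 2), C₃ + C₄, Q₃ + Q₄, by positivity, by positivity, ?_⟩
  intro w S y B G d T hg hP HH hw hy hS hB hG hd hT hH
  have hw0 : 0 < w := one_pos.trans_le hw
  have hB0 : 0 < B := one_pos.trans_le hB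
  have hS0 : 0 ≤ S := by rw [hS]; positivity
  obtain ⟨W, hW⟩ : ∃ W : ℝ, W = w ^ (1 - m) := ⟨_, rfl⟩
  have hW0 : 0 < W := by rw [hW]; positivity
  obtain ⟨q, hq⟩ : ∃ q : ℝ, q = w ^ p := ⟨_, rfl⟩
  have hq0 : 0 < q := by rw [hq]; positivity
  obtain ⟨a, ha⟩ : ∃ a : ℝ, a = S / w := ⟨_, rfl⟩
  have ha0 : 0 ≤ a := by rw [ha]; positivity
  have hSa : S = a * w := by rw [ha]; field_simp
  obtain ⟨r, hr⟩ : ∃ r : ℝ, r = T + q := ⟨_, rfl⟩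
  obtain ⟨e, he⟩ : ∃ e : ℝ, e = B * y + C₀ * w ^ σ := ⟨_, rfl⟩
  have hσ0 : 0 < w ^ σ := by positivity
  have hBy : 0 ≤ B * y := by positivity
  have hCσ : 0 ≤ C₀ * w ^ σ := by positivity
  have he0 : 0 ≤ e := by rw [he]; positivity
  have p1 : w ^ (1 - m - 1) = W / w := by rw [hW, Real.rpow_sub_one hw0.ne']
  have p2 : w ^ (1 - m - 1 - 1) = W / w / w := by
    rw [Real.rpow_sub_one hw0.ne', p1]
  have p3 : w ^ (1 - m + p) = W * q := by rw [hW, hq, Real.rpow_add hw0]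
  have p4 : w ^ (1 - m + p - 1) = W * q / w := by rw [Real.rpow_sub_one hw0.ne', p3]
  have p5 : w ^ (1 - m + 2) = W * w ^ 2 := by
    rw [hW, Real.rpow_add hw0, Real.rpow_two]
  have p6 : w ^ (1 - m + 2 * p) = W * q ^ 2 := by
    rw [hW, hq, Real.rpow_add hw0, mul_comm 2 p, Real.rpow_mul hw0.le, Real.rpow_two]
  have p7 : w ^ (1 - m + 2 * σ) = W * (w ^ σ) ^ 2 := by
    rw [hW, Real.rpow_add hw0, mul_comm 2 σ, Real.rpow_mul hw0.le, Real.rpow_two]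
  have hd' : S * d ≤ e ^ 2 := by
    calc S * d ≤ S * B ^ 2 := by gcongr; exact (le_abs_self d).trans hd
      _ = (B * y) ^ 2 := by rw [hS]; ring
      _ ≤ e ^ 2 := by rw [he]; gcongr; linarith
  have main := hK q a e r G (S * d) hq0.le ha0 he0 (by rw [hr, hq, he]; exact hT)
    (by rw [he]; linarith) hd'
  -- Eliminate the Hessian.
  have step : (w ^ (1 - m) * G * T + (1 - m) * w ^ (1 - m - 1) * S * T + w ^ (1 - m) * T ^ 2
          - w ^ (1 - m) * hg - (1 - m) * w ^ (1 - m - 1) * hP - w ^ (1 - m) * HH)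
        + (1 + m) / 2 * (w ^ (1 - m - 1) * S * G + (1 - m - 1) * w ^ (1 - m - 1 - 1) * S ^ 2
          + 2 * w ^ (1 - m - 1) * hP + w ^ (1 - m - 1) * S * T)
        + 1 / 2 * (w ^ (1 - m) * S * d + (1 - m) * w ^ (1 - m - 1) * S * G
          + 2 * w ^ (1 - m) * hg)
        + D * (w ^ (1 - m + p) * G + (1 - m + p) * w ^ (1 - m + p - 1) * S
          + w ^ (1 - m + p) * T)
      ≤ W * (-c₁ * q ^ 2 - δ / 2 * (a * q) - α * a ^ 2 - 2 * ν * (q * r) + ν * r ^ 2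
        + b * (a * r) + G * (-q + r) + a * G + S * d / 2 + D * (q * (G + r))) := by
    have hH' : (1 - ν) * (T - m * a) ^ 2 ≤ HH - 2 * m * (hP / w) + m ^ 2 * a ^ 2 := by
      rw [hν, ha, sub_sub_cancel]; exact hH
    have hT' : T = r - q := by rw [hr]; ring
    have hαν : α = (1 + m) / 2 * m - m ^ 2 * ν := by
      rw [hα, hν]; field_simp; ring
    have hbν : b = 1 - m + (1 + m) / 2 + 2 * m * (1 - ν) := by
      rw [hb, hν]; ring
    have hδb : δ / 2 = 1 - m + (1 + m) / 2 + 2 * m * (1 - ν) - (ν + c₁) * (1 - m + p) := by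
      rw [← hbD, hbν, hD]
    rw [p1, p2, p3, p4, ← hW, ← sub_nonneg, hδb, hαν, hbν, hD, hT', ha]
    rw [hT', ha] at hH'
    simp only [div_eq_mul_inv _ w] at hH' ⊢
    rw [bochner_combination]
    exact mul_nonneg hW0.le (by linarith)
  -- Absorb the error.
  have he2 : K * e ^ 2 ≤ α / 4 * a ^ 2 + K₁ * (B ^ 4 * w ^ 2) + K₂ * (w ^ σ) ^ 2 := by
    have h1 : e ^ 2 ≤ 2 * (B ^ 2 * S) + 2 * C₀ ^ 2 * (w ^ σ) ^ 2 := by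
      rw [he, hS]
      linarith [sq_nonneg (B * y - C₀ * w ^ σ)]
    have h2 : 2 * K * (B ^ 2 * S) ≤ α / 4 * a ^ 2 + K₁ * (B ^ 4 * w ^ 2) := by
      have : α / 4 * a ^ 2 + K₁ * (B ^ 4 * w ^ 2) - 2 * K * (B ^ 2 * S)
          = (α * a / 2 - 2 * K * B ^ 2 * w) ^ 2 / α := by
        rw [hK₁, hSa]; field_simp; ring
      have := div_nonneg (sq_nonneg (α * a / 2 - 2 * K * B ^ 2 * w)) hα0.le
      linarith
    have h3 := mul_le_mul_of_nonneg_left h1 hK0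
    rw [hK₂]
    linarith
  have h5 : K₁ * (B ^ 4 * (W * w ^ 2)) ≤ c₁ / 4 * (W * q ^ 2) + C₃ * B ^ (Q₃ + Q₄) := by
    have h := hC₃ w B hw hB
    rw [p5, p6] at h
    have h' : B ^ Q₃ ≤ B ^ (Q₃ + Q₄) := pow_le_pow_right₀ hB (Nat.le_add_right _ _)
    exact h.trans (by gcongr)
  have h6 : K₂ * (W * (w ^ σ) ^ 2) ≤ c₁ / 4 * (W * q ^ 2) + C₄ * B ^ (Q₃ + Q₄) := by
    have h := hC₄ w B hw hB
    rw [p7, p6, pow_zero, one_mul] at h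
    have h' : B ^ Q₄ ≤ B ^ (Q₃ + Q₄) := pow_le_pow_right₀ hB (Nat.le_add_left _ _)
    exact h.trans (by gcongr)
  -- Compare the powers, using `m ≤ p`.
  have h7 : w ^ (p + 1) ≤ W * q ^ 2 := by
    rw [← p6]; exact Real.rpow_le_rpow_of_exponent_le hw (by linarith)
  have h8 : S ≤ W * (a * q) := by
    have : 1 ≤ w ^ (1 - m + p - 1) := Real.one_le_rpow hw (by linarith)
    calc S = 1 * S := (one_mul S).symm
      _ ≤ w ^ (1 - m + p - 1) * S := by gcongr
      _ = W * (a * q) := by rw [p4, ha]; field_simp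
  have h9 : min (c₁ / 4) (δ / 2) * w ^ (p + 1) ≤ c₁ / 4 * (W * q ^ 2) :=
    mul_le_mul (min_le_left _ _) h7 (by positivity) (by positivity)
  have h10 : min (c₁ / 4) (δ / 2) * S ≤ δ / 2 * (W * (a * q)) :=
    mul_le_mul (min_le_right _ _) h8 hS0 (by positivity)
  refine step.trans ((mul_le_mul_of_nonneg_left main hW0.le).trans ?_)
  have h11 := mul_le_mul_of_nonneg_left he2 hW0.le
  have h12 : 0 ≤ W * (α * a ^ 2) := by positivity
  linarith only [h5, h6, h9, h10, h11, h12]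

/-! ### A compactly supported approximation of the Gaussian -/

theorem hasDerivAt_max_zero_pow (k : ℕ) (t : ℝ) :
    HasDerivAt (fun s : ℝ => max s 0 ^ (k + 2)) ((k + 2) * max t 0 ^ (k + 1)) t := by
  rcases lt_trichotomy t 0 with h | rfl | h
  · have : (fun s : ℝ => max s 0 ^ (k + 2)) =ᶠ[nhds t] fun _ => 0 := by
      filter_upwards [gt_mem_nhds h] with s hs
      simp [max_eq_right hs.le]
    rw [max_eq_right h.le, zero_pow (by omega), mul_zero]
    exact (hasDerivAt_const t (0 : ℝ)).congr_of_eventuallyEq this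
  · have h1 : HasDerivWithinAt (fun s : ℝ => max s 0 ^ (k + 2)) 0 (Set.Iic 0) 0 :=
      (hasDerivWithinAt_const (0 : ℝ) (Set.Iic 0) (0 : ℝ)).congr
        (fun s hs => by simp [max_eq_right (Set.mem_Iic.1 hs)]) (by simp)
    have h2 : HasDerivWithinAt (fun s : ℝ => max s 0 ^ (k + 2)) 0 (Set.Ici 0) 0 := by
      have := (hasDerivAt_pow (k + 2) (0 : ℝ)).hasDerivWithinAt (s := Set.Ici 0)
      rw [show k + 2 - 1 = k + 1 from rfl, zero_pow k.succ_ne_zero, mul_zero] at this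
      exact this.congr (fun s hs => by simp [max_eq_left (Set.mem_Ici.1 hs)]) (by simp)
    have := h1.union h2
    rw [Set.Iic_union_Ici, hasDerivWithinAt_univ] at this
    simpa using this
  · have : (fun s : ℝ => max s 0 ^ (k + 2)) =ᶠ[nhds t] fun s => s ^ (k + 2) := by
      filter_upwards [lt_mem_nhds h] with s hs
      simp [max_eq_left hs.le]
    rw [max_eq_left h.le]
    have h2 := (hasDerivAt_pow (k + 2) t).congr_of_eventuallyEq this
    rw [show k + 2 - 1 = k + 1 from rfl, Nat.cast_add, Nat.cast_ofNat] at h2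
    exact h2

theorem contDiff_max_zero_pow (k j : ℕ) : ContDiff ℝ k (fun s : ℝ => max s 0 ^ (k + 1 + j)) := by
  induction k with
  | zero => exact contDiff_zero.2 (by fun_prop)
  | succ k ih =>
    have hd : ∀ t : ℝ, HasDerivAt (fun s : ℝ => max s 0 ^ (k + 1 + 1 + j))
        (((k + j : ℕ) + 2) * max t 0 ^ (k + 1 + j)) t := fun t => by
      have := hasDerivAt_max_zero_pow (k + j) t
      rwa [show k + j + 2 = k + 1 + 1 + j by omega, show k + j + 1 = k + 1 + j by omega] at this
    push_cast
    rw [contDiff_succ_iff_deriv]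
    refine ⟨fun t => (hd t).differentiableAt, by simp, ?_⟩
    rw [funext fun t => (hd t).deriv]
    exact contDiff_const.mul ih

section Cutoff

variable {n : ℕ}

/-- The radial profile `(1 - c |x|²)₊`, whose `N`-th power with `c = γ / N` is a compactly
supported approximation from below of `exp (-γ |x|²)`. -/
noncomputable def parabolicCap (c : ℝ) (x : EuclideanSpace ℝ (Fin n)) : ℝ :=
  max (1 - c * ‖x‖ ^ 2) 0

theorem parabolicCap_nonneg (c : ℝ) (x : EuclideanSpace ℝ (Fin n)) : 0 ≤ parabolicCap c x :=
  le_max_right _ _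

theorem parabolicCap_le_exp (c : ℝ) (x : EuclideanSpace ℝ (Fin n)) :
    parabolicCap c x ≤ Real.exp (-(c * ‖x‖ ^ 2)) :=
  max_le (Real.one_sub_le_exp_neg _) (Real.exp_pos _).le

theorem parabolicCap_le_one {c : ℝ} (hc : 0 ≤ c) (x : EuclideanSpace ℝ (Fin n)) :
    parabolicCap c x ≤ 1 :=
  max_le (sub_le_self _ (by positivity)) zero_le_one

theorem contDiff_parabolicCap_pow (c : ℝ) (k : ℕ) :
    ContDiff ℝ 2 (fun x : EuclideanSpace ℝ (Fin n) => parabolicCap c x ^ (k + 3)) := by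
  have h := contDiff_max_zero_pow 2 k
  rw [show 2 + 1 + k = k + 3 by omega] at h
  exact h.comp (contDiff_const.sub (contDiff_const.mul (contDiff_norm_sq ℝ)))

theorem hasCompactSupport_parabolicCap_pow {c : ℝ} (hc : 0 < c) {k : ℕ} (hk : k ≠ 0) :
    HasCompactSupport (fun x : EuclideanSpace ℝ (Fin n) => parabolicCap c x ^ k) := by
  refine HasCompactSupport.intro (isCompact_closedBall (0 : EuclideanSpace ℝ (Fin n))
    (1 + 1 / c)) fun x hx => ?_
  rw [mem_closedBall_zero_iff, not_le] at hx
  have hc' : 0 < 1 / c := by positivity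
  have h : 1 / c ≤ ‖x‖ ^ 2 := by nlinarith
  have : 1 ≤ c * ‖x‖ ^ 2 := by rwa [div_le_iff₀' hc] at h
  simp [parabolicCap, max_eq_right (sub_nonpos.2 this), hk]

theorem partialDeriv_parabolicCap_pow (c : ℝ) (k : ℕ) (i : Fin n) :
    partialDeriv i (fun x : EuclideanSpace ℝ (Fin n) => parabolicCap c x ^ (k + 2))
      = fun x => -(2 * c * (k + 2)) * (x i * parabolicCap c x ^ (k + 1)) := by
  funext x
  have h1 : HasFDerivAt (fun y : EuclideanSpace ℝ (Fin n) => 1 - c * ‖y‖ ^ 2)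
      (-(c • (2 • innerSL ℝ x))) x :=
    (((hasStrictFDerivAt_norm_sq x).hasFDerivAt.const_mul c).const_sub 1)
  have h2 := (hasDerivAt_max_zero_pow k (1 - c * ‖x‖ ^ 2)).comp_hasFDerivAt x h1
  have h3 : HasFDerivAt (fun x : EuclideanSpace ℝ (Fin n) => parabolicCap c x ^ (k + 2)) _ x := h2
  rw [partialDeriv, h3.fderiv]
  simp [parabolicCap, EuclideanSpace.inner_single_right]
  ring

theorem partialDeriv_coord (i : Fin n) (x : EuclideanSpace ℝ (Fin n)) :
    partialDeriv i (fun y : EuclideanSpace ℝ (Fin n) => y i) x = 1 := by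
  have h : HasFDerivAt (fun y : EuclideanSpace ℝ (Fin n) => y i)
      (EuclideanSpace.proj i : EuclideanSpace ℝ (Fin n) →L[ℝ] ℝ) x :=
    (EuclideanSpace.proj i : EuclideanSpace ℝ (Fin n) →L[ℝ] ℝ).hasFDerivAt
  rw [partialDeriv, h.fderiv]
  simp

theorem sum_partialDeriv_partialDeriv_parabolicCap_pow (c : ℝ) (k : ℕ)
    (x : EuclideanSpace ℝ (Fin n)) :
    ∑ i, partialDeriv i (partialDeriv i
        (fun x : EuclideanSpace ℝ (Fin n) => parabolicCap c x ^ (k + 3))) x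
      = -(2 * c * (k + 3)) * (n * parabolicCap c x ^ (k + 2)
          - 2 * c * (k + 2) * ‖x‖ ^ 2 * parabolicCap c x ^ (k + 1)) := by
  have hd : Differentiable ℝ (fun x : EuclideanSpace ℝ (Fin n) => parabolicCap c x ^ (k + 2)) := by
    have h := contDiff_max_zero_pow 1 k
    rw [show 1 + 1 + k = k + 2 by omega] at h
    exact (h.comp (contDiff_const.sub (contDiff_const.mul (contDiff_norm_sq ℝ)))).differentiable
      one_ne_zero
  have e : ∀ i : Fin n, partialDeriv i (partialDeriv i
        (fun x : EuclideanSpace ℝ (Fin n) => parabolicCap c x ^ (k + 3))) x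
      = -(2 * c * (k + 3)) * (parabolicCap c x ^ (k + 2)
          - 2 * c * (k + 2) * parabolicCap c x ^ (k + 1) * x i ^ 2) := by
    intro i
    have h1 := partialDeriv_parabolicCap_pow (n := n) c (k + 1) i
    rw [show k + 1 + 2 = k + 3 by omega, show k + 1 + 1 = k + 2 by omega] at h1
    have hc : DifferentiableAt ℝ (fun y : EuclideanSpace ℝ (Fin n) => y i) x :=
      (EuclideanSpace.proj i : EuclideanSpace ℝ (Fin n) →L[ℝ] ℝ).differentiableAt
    rw [h1, partialDeriv_mul
        (g := fun y : EuclideanSpace ℝ (Fin n) => y i * parabolicCap c y ^ (k + 2)) (differentiableAt_const _) (hc.mul (hd x)),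
      partialDeriv_mul hc (hd x), partialDeriv_coord, partialDeriv_parabolicCap_pow]
    simp only [partialDeriv, fderiv_fun_const]
    push_cast
    simp
    ring
  simp only [e, ← Finset.mul_sum, Finset.sum_sub_distrib, EuclideanSpace.real_norm_sq_eq,
    Finset.sum_const, Finset.card_univ, Fintype.card_fin, nsmul_eq_mul]
  ring

theorem tendsto_parabolicCap_pow {γ : ℝ} (x : EuclideanSpace ℝ (Fin n)) :
    Filter.Tendsto (fun N : ℕ => parabolicCap (γ / N) x ^ N) Filter.atTop
      (nhds (Real.exp (-γ * ‖x‖ ^ 2))) := by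
  refine (Real.tendsto_one_add_div_pow_exp (-γ * ‖x‖ ^ 2)).congr' ?_
  have h : Filter.Tendsto (fun N : ℕ => 1 - γ / N * ‖x‖ ^ 2) Filter.atTop (nhds 1) := by
    have := ((tendsto_const_div_atTop_nhds_zero_nat γ).mul_const (‖x‖ ^ 2)).const_sub 1
    simpa using this
  filter_upwards [h.eventually (lt_mem_nhds one_pos)] with N hN
  rw [parabolicCap, max_eq_left hN.le]
  congr 1
  ring

end Cutoff

theorem integrable_one_add_norm_pow_mul_exp {n : ℕ} {b : ℝ} (hb : 0 < b) (Q : ℕ) :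
    Integrable (fun x : EuclideanSpace ℝ (Fin n) =>
      (1 + ‖x‖) ^ Q * Real.exp (-(b * ‖x‖ ^ 2))) volume := by
  have h1 : Integrable (fun x : EuclideanSpace ℝ (Fin n) => (1 + ‖x‖) ^ (-((n : ℝ) + 1))) volume :=
    integrable_one_add_norm (by simp)
  refine (h1.const_mul ((Q + (n + 1)).factorial * Real.exp (1 + 1 / (4 * b)))).mono'
    (by fun_prop) (Filter.Eventually.of_forall fun x => ?_)
  set r := ‖x‖ with hr
  have hr0 : 0 ≤ r := norm_nonneg x
  rw [Real.norm_of_nonneg (by positivity), Real.rpow_neg (by positivity),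
    show ((n : ℝ) + 1) = ((n + 1 : ℕ) : ℝ) by push_cast; rfl, Real.rpow_natCast,
    ← div_eq_mul_inv, le_div_iff₀ (by positivity)]
  have h2 := Real.pow_div_factorial_le_exp (1 + r) (by positivity) (Q + (n + 1))
  rw [div_le_iff₀ (by positivity)] at h2
  have h3 : 1 + r ≤ 1 + 1 / (4 * b) + b * r ^ 2 := by
    have : 1 / (4 * b) + b * r ^ 2 - r = (2 * b * r - 1) ^ 2 / (4 * b) := by
      field_simp
      ring
    have := div_nonneg (sq_nonneg (2 * b * r - 1)) (by positivity : 0 ≤ 4 * b)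
    linarith
  calc (1 + r) ^ Q * Real.exp (-(b * r ^ 2)) * (1 + r) ^ (n + 1)
      = (1 + r) ^ (Q + (n + 1)) * Real.exp (-(b * r ^ 2)) := by rw [pow_add]; ring
    _ ≤ Real.exp (1 + 1 / (4 * b) + b * r ^ 2) * (Q + (n + 1)).factorial
          * Real.exp (-(b * r ^ 2)) := by
        gcongr
        exact h2.trans (by gcongr)
    _ = _ := by
        rw [mul_right_comm, ← Real.exp_add, mul_comm]
        congr 2
        ring

/-! ### The energy estimate -/

/-- The Cauchy–Schwarz inequality `(tr X)² ≤ n |X|²` for `X = H - t P ⊗ P`. -/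
theorem trace_sub_sq_le {n : ℕ} (hn : 0 < n) (H : Fin n → Fin n → ℝ) (P : Fin n → ℝ) (t : ℝ) :
    1 / (n : ℝ) * (∑ i, H i i - t * ∑ i, P i ^ 2) ^ 2
      ≤ ∑ i, ∑ j, H i j ^ 2 - 2 * t * (∑ i, ∑ j, P i * P j * H i j)
        + t ^ 2 * (∑ i, P i ^ 2) ^ 2 := by
  have hn' : (0 : ℝ) < n := by exact_mod_cast hn
  have h1 : (∑ i, (H i i - t * P i ^ 2)) ^ 2 ≤ n * ∑ i, (H i i - t * P i ^ 2) ^ 2 := by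
    have := sq_sum_le_card_mul_sum_sq (s := Finset.univ) (f := fun i => H i i - t * P i ^ 2)
    rwa [Finset.card_univ, Fintype.card_fin] at this
  have h2 : ∑ i, (H i i - t * P i ^ 2) ^ 2 ≤ ∑ i, ∑ j, (H i j - t * (P i * P j)) ^ 2 := by
    refine Finset.sum_le_sum fun i _ => ?_
    refine le_trans (le_of_eq (by ring)) (Finset.single_le_sum
      (f := fun j => (H i j - t * (P i * P j)) ^ 2) (fun j _ => sq_nonneg _) (Finset.mem_univ i))
  have h3 : ∑ i, ∑ j, (H i j - t * (P i * P j)) ^ 2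
      = ∑ i, ∑ j, H i j ^ 2 - 2 * t * (∑ i, ∑ j, P i * P j * H i j)
        + t ^ 2 * (∑ i, P i ^ 2) ^ 2 := by
    have e : ∀ i j, (H i j - t * (P i * P j)) ^ 2
        = H i j ^ 2 - 2 * t * (P i * P j * H i j) + t ^ 2 * (P i ^ 2 * P j ^ 2) := by
      intro i j; ring
    simp only [e, Finset.sum_add_distrib, Finset.sum_sub_distrib, ← Finset.mul_sum,
      ← Finset.sum_mul]
    ring
  rw [Finset.sum_sub_distrib, ← Finset.mul_sum] at h1
  rw [one_div, inv_mul_le_iff₀ hn', ← h3]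
  exact h1.trans (by gcongr)

/-- The exponent `m` of the Gidas–Spruck argument exists exactly because `p` is subcritical. -/
theorem exists_gidasSpruck_exponent {n : ℕ} (hn : 2 ≤ n) {p : ℝ} (hp : 1 < p)
    (hp' : (p : EReal) < sobolevExponent n) :
    ∃ m : ℝ, 0 < m ∧ m ≤ p ∧ m * (n - 2) < n ∧ 2 * (n - 1) * p < (n + 2) * (m + 1) := by
  have hn2 : (2 : ℝ) ≤ n := by exact_mod_cast hn
  have hpn : p * (n - 2) < n + 2 := by
    rcases hn.eq_or_lt with h | h
    · subst h; norm_num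
    · have h3 : (2 : ℝ) < n := by exact_mod_cast h
      rw [sobolevExponent, if_neg (by omega), EReal.coe_lt_coe_iff,
        lt_div_iff₀ (by linarith)] at hp'
      exact hp'
  rcases lt_or_ge (p * (n - 2)) n with h | h
  · exact ⟨p, by linarith, le_rfl, h, by nlinarith⟩
  · have h3 : (0 : ℝ) < n - 2 := by
      rcases hn2.eq_or_lt with h' | h'
      · rw [← h'] at h; norm_num at h
      · linarith
    have hlt : max 0 (2 * (n - 1) * p / (n + 2) - 1) < n / ((n : ℝ) - 2) := by
      refine max_lt (by positivity) ?_
      rw [sub_lt_iff_lt_add, div_lt_iff₀ (by linarith)]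
      have : ((n : ℝ) / (n - 2) + 1) * (n + 2) = 2 * (n - 1) * ((n + 2) / (n - 2)) := by
        field_simp; ring
      rw [this]
      have : p < (n + 2) / (n - 2) := by rwa [lt_div_iff₀ h3]
      exact mul_lt_mul_of_pos_left this (by linarith)
    obtain ⟨m, hm1, hm2⟩ := exists_between hlt
    rw [max_lt_iff, sub_lt_iff_lt_add, div_lt_iff₀ (by linarith)] at hm1
    rw [lt_div_iff₀ h3] at hm2
    exact ⟨m, hm1.1, le_of_mul_le_mul_right (hm2.le.trans h) h3, hm2, by linarith [hm1.2]⟩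

/-- In terms of `w = u + 1` the equation reads `Δw = -w ^ p` up to terms of lower order. -/
theorem abs_add_one_rpow_sub_le {p β v : ℝ} (hp : 1 < p) (hβ : 0 ≤ β) (hv : 0 ≤ v) :
    |(v + 1) ^ p - v ^ p + β * v| ≤ (p + β) * (v + 1) ^ max (p - 1) 1 := by
  have hw : 1 ≤ v + 1 := by linarith
  have h1 : v ^ p ≤ (v + 1) ^ p := Real.rpow_le_rpow hv (by linarith) (by linarith)
  rw [abs_of_nonneg (by nlinarith)]
  have h2 : (v + 1) ^ p - v ^ p ≤ p * (v + 1) ^ (p - 1) := by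
    have hb := one_add_mul_self_le_rpow_one_add (s := -1 / (v + 1)) (p := p)
      (by rw [le_div_iff₀ (by linarith)]; linarith) hp.le
    have h3 : 1 + -1 / (v + 1) = v / (v + 1) := by field_simp; ring
    rw [h3, Real.div_rpow hv (by linarith), le_div_iff₀ (by positivity)] at hb
    rw [Real.rpow_sub_one (by linarith)]
    have : (1 + p * (-1 / (v + 1))) * (v + 1) ^ p
        = (v + 1) ^ p - p * ((v + 1) ^ p / (v + 1)) := by
      field_simp; ring
    linarith
  have h4 : (v + 1) ^ (p - 1) ≤ (v + 1) ^ max (p - 1) 1 :=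
    Real.rpow_le_rpow_of_exponent_le hw (le_max_left _ _)
  have h5 : v ≤ (v + 1) ^ max (p - 1) 1 := by
    have := Real.rpow_le_rpow_of_exponent_le hw (le_max_right (p - 1) 1)
    rw [Real.rpow_one] at this
    linarith
  have h6 := mul_le_mul_of_nonneg_left h4 (by linarith : 0 ≤ p)
  have h7 := mul_le_mul_of_nonneg_left h5 hβ
  linarith

/-- The quotient `Δφ / φ` for the cutoff `φ = τ ^ (k + 3)`, `τ = (1 - b r²)₊`. -/
theorem abs_laplacian_cutoff_div_le {n k : ℕ} {b γ Λ τ r : ℝ} (hb : 0 < b)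
    (hbγ : b * (k + 3) = γ) (hΛ1 : 1 ≤ Λ) (hΛγ : 2 * γ * n ≤ Λ) (hΛγ' : 2 * γ ≤ Λ) (hτ : 0 < τ)
    (hτ1 : τ ≤ 1) (hr : 0 ≤ r) :
    |-(2 * γ) * (n * τ - 2 * b * (k + 2) * r ^ 2) / τ ^ 2| ≤ (Λ * (1 + r) / τ) ^ 2 := by
  have hγ : 0 < γ := by rw [← hbγ]; positivity
  rw [abs_div, abs_mul, abs_neg, abs_of_pos (by positivity : 0 < 2 * γ),
    abs_of_pos (by positivity : 0 < τ ^ 2), div_pow]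
  refine div_le_div_of_nonneg_right ?_ (by positivity)
  have hbk : b * (k + 2) ≤ γ := by rw [← hbγ]; gcongr; norm_num
  have h1 : |n * τ - 2 * b * (k + 2) * r ^ 2| ≤ n + 2 * γ * r ^ 2 := by
    refine (abs_sub _ _).trans ?_
    rw [abs_of_nonneg (by positivity), abs_of_nonneg (by positivity)]
    have h2 : n * τ ≤ n := mul_le_of_le_one_right (by positivity) hτ1
    have h3 : b * (k + 2) * r ^ 2 ≤ γ * r ^ 2 := by gcongr
    linarith
  calc 2 * γ * |n * τ - 2 * b * (k + 2) * r ^ 2| ≤ 2 * γ * (n + 2 * γ * r ^ 2) := by gcongr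
    _ = 2 * γ * n + (2 * γ) ^ 2 * r ^ 2 := by ring
    _ ≤ Λ ^ 2 + Λ ^ 2 * r ^ 2 := by
        gcongr
        exact hΛγ.trans (le_self_pow₀ hΛ1 two_ne_zero)
    _ ≤ Λ ^ 2 + Λ ^ 2 * r ^ 2 + 2 * (Λ ^ 2 * r) := le_add_of_nonneg_right (by positivity)
    _ = (Λ * (1 + r)) ^ 2 := by ring

/-- Powers of `1 / τ` are absorbed by the cutoff, leaving half of the Gaussian decay. -/
theorem cutoff_mul_pow_le {k Q : ℕ} {b γ Λ τ r : ℝ} (hbγ : b * (k + 3) = γ) (hb : 0 < b)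
    (hΛ : 0 ≤ Λ) (hτ : 0 < τ) (hτe : τ ≤ Real.exp (-(b * r ^ 2))) (hr : 0 ≤ r)
    (hQ : 2 * Q + 3 ≤ k + 3) :
    τ ^ (k + 3) * (Λ * (1 + r) / τ) ^ Q
      ≤ Λ ^ Q * ((1 + r) ^ Q * Real.exp (-(γ / 2 * r ^ 2))) := by
  have h1 : τ ^ (k + 3) * (Λ * (1 + r) / τ) ^ Q = (Λ * (1 + r)) ^ Q * τ ^ (k + 3 - Q) := by
    rw [div_pow, pow_sub₀ _ hτ.ne' (by omega)]
    ring
  have h2 : τ ^ (k + 3 - Q) ≤ Real.exp (-(γ / 2 * r ^ 2)) := by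
    calc τ ^ (k + 3 - Q) ≤ Real.exp (-(b * r ^ 2)) ^ (k + 3 - Q) := by gcongr
      _ ≤ _ := by
          rw [← Real.exp_nat_mul, Real.exp_le_exp, Nat.cast_sub (by omega)]
          have h : (2 * Q + 3 : ℝ) ≤ k + 3 := by exact_mod_cast hQ
          have h3 : γ / 2 ≤ b * ((k + 3 : ℕ) - (Q : ℝ)) := by
            have := mul_nonneg hb.le (by linarith : (0 : ℝ) ≤ k - 2 * Q)
            have := mul_nonneg hb.le (by norm_num : (0 : ℝ) ≤ 3)
            rw [← hbγ]
            push_cast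
            linarith
          have h4 := mul_le_mul_of_nonneg_right h3 (sq_nonneg r)
          linarith
  rw [h1, mul_pow, mul_assoc]
  gcongr

set_option maxHeartbeats 1000000 in
/-- The energy density, integrated against the compactly supported approximations of the Gaussian,
stays bounded. -/
theorem exists_integral_cutoff_le {n : ℕ} (hn : 2 ≤ n) {p : ℝ} (hp : 1 < p)
    (hp' : (p : EReal) < sobolevExponent n) {lam β : ℝ} (hlam : 0 < lam) (hβ : 0 ≤ β)
    {u : EuclideanSpace ℝ (Fin n) → ℝ} (hu : IsNonnegClassicalSolution n p lam β u)
    {γ : ℝ} (hγ : 0 < γ) :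
    ∃ C : ℝ, ∃ N₀ : ℕ, 3 ≤ N₀ ∧ ∀ N : ℕ, N₀ ≤ N →
      ∫ x, parabolicCap (γ / N) x ^ N * ((u x + 1) ^ (p + 1) + ‖gradient u x‖ ^ 2) ≤ C := by
  obtain ⟨m, hm0, hmp, hm1, hm2⟩ := exists_gidasSpruck_exponent hn hp hp'
  have hσ : max (p - 1) 1 < p := max_lt (by linarith) hp
  obtain ⟨D, c, C, Q, hc, hC, key⟩ := exists_pointwise_bound hn hp hm0 hmp hm1 hm2 hσ
    (by linarith : 0 ≤ p + β)
  -- `Λ (1 + |x|) / τ` will dominate the drift coefficient, `|∇φ| / φ` and `(|Δφ| / φ) ^ (1 / 2)`.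
  set Λ : ℝ := 1 + lam + 2 * γ * n with hΛ
  have hn2 : (2 : ℝ) ≤ n := by exact_mod_cast hn
  have hΛγ : 2 * γ * n ≤ Λ := by linarith
  have hΛγ' : 2 * γ ≤ Λ := by nlinarith
  have hΛlam : lam ≤ Λ := by
    have : 0 ≤ 2 * γ * n := by positivity
    linarith
  have hΛ1 : 1 ≤ Λ := by
    have : 0 ≤ 2 * γ * n := by positivity
    linarith
  refine ⟨(∫ x : EuclideanSpace ℝ (Fin n),
    C * Λ ^ Q * ((1 + ‖x‖) ^ Q * Real.exp (-(γ / 2 * ‖x‖ ^ 2)))) / c, 2 * Q + 3, by omega,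
    fun N hN => ?_⟩
  have hN0 : (0 : ℝ) < N := by exact_mod_cast (by omega : 0 < N)
  obtain ⟨k, rfl⟩ : ∃ k, N = k + 3 := ⟨N - 3, by omega⟩
  set b : ℝ := γ / ((k + 3 : ℕ) : ℝ) with hb
  have hb0 : 0 < b := by positivity
  have hbγ : b * (k + 3) = γ := by rw [hb]; push_cast at hN0 ⊢; field_simp
  -- The function and the cutoff to which the divergence identities apply.
  set w : EuclideanSpace ℝ (Fin n) → ℝ := fun x => u x + 1 with hw
  set φ : EuclideanSpace ℝ (Fin n) → ℝ := fun x => parabolicCap b x ^ (k + 3) with hφ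
  have hw2 : ContDiff ℝ 2 w := hu.contDiff.add contDiff_const
  have hw1 : ∀ x, 1 ≤ w x := fun x => by simpa [hw] using hu.nonneg x
  have hwpos : ∀ x, 0 < w x := fun x => one_pos.trans_le (hw1 x)
  have hφ2 : ContDiff ℝ 2 φ := contDiff_parabolicCap_pow b k
  have hφc : HasCompactSupport φ := hasCompactSupport_parabolicCap_pow hb0 (by omega)
  have hφ0 : ∀ x, 0 ≤ φ x := fun x => pow_nonneg (parabolicCap_nonneg b x) _
  have hpw : ∀ i, partialDeriv i w = partialDeriv i u := fun i => partialDeriv_add_const 1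
  have hzero := (((hasZeroIntegral_bochner hw2 hwpos hφ2 hφc (1 - m)).add
    ((hasZeroIntegral_div_sq_smul_gradient hw2 hwpos hφ2 hφc (1 - m - 1)).const_mul
      ((1 + m) / 2))).add
    ((hasZeroIntegral_div_sq_smul_gradient_cutoff hw2 hwpos hφ2 hφc (1 - m)).const_mul
      (1 / 2))).add
    ((hasZeroIntegral_div_smul_gradient hw2 hwpos hφ2 hφc (1 - m + p)).const_mul D)
  have hgi : Integrable (fun x : EuclideanSpace ℝ (Fin n) =>
      C * Λ ^ Q * ((1 + ‖x‖) ^ Q * Real.exp (-(γ / 2 * ‖x‖ ^ 2)))) volume :=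
    (integrable_one_add_norm_pow_mul_exp (by positivity) Q).const_mul _
  have hE : Continuous fun x => w x ^ (p + 1) + ‖gradient u x‖ ^ 2 := by
    refine (hw2.continuous.rpow_const fun x => Or.inl (hwpos x).ne').add ?_
    simp_rw [norm_gradient_sq]
    exact continuous_finsetSum _ fun i _ =>
      (continuous_partialDeriv (hu.contDiff.of_le (by norm_num))).pow 2
  have hEi : Integrable (fun x => φ x * (w x ^ (p + 1) + ‖gradient u x‖ ^ 2)) volume :=
    (hφ2.continuous.mul hE).integrable_of_hasCompactSupport hφc.mul_right
  have hd1 : ∀ i x, partialDeriv i φ x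
      = -(2 * γ) * (x i * parabolicCap b x ^ (k + 2)) := by
    intro i x
    have h := partialDeriv_parabolicCap_pow (n := n) b (k + 1) i
    rw [show k + 1 + 2 = k + 3 by omega, show k + 1 + 1 = k + 2 by omega] at h
    rw [hφ, h, ← hbγ]
    push_cast
    ring
  have hd2 : ∀ x, ∑ i, partialDeriv i (partialDeriv i φ) x
      = -(2 * γ) * (n * parabolicCap b x ^ (k + 2)
          - 2 * b * (k + 2) * ‖x‖ ^ 2 * parabolicCap b x ^ (k + 1)) := by
    intro x
    rw [hφ, sum_partialDeriv_partialDeriv_parabolicCap_pow, ← hbγ]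
    ring
  rw [le_div_iff₀ hc, ← integral_mul_const, ← sub_nonneg, ← integral_sub hgi (hEi.mul_const c),
    ← hzero.2]
  refine integral_mono hzero.1 (hgi.sub (hEi.mul_const c)) fun x => ?_
  have hτ0 := parabolicCap_nonneg b x
  rcases hτ0.eq_or_lt with hτ | hτ
  · -- Outside the support of the cutoff.
    have h1 : ∀ i, partialDeriv i φ x = 0 := fun i => by simp [hd1, ← hτ]
    have h2 : φ x = 0 := by simp [hφ, ← hτ]
    have h3 : ∑ i, partialDeriv i (partialDeriv i φ) x = 0 := by simp [hd2, ← hτ]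
    simp only [h1, h2, h3, zero_mul, mul_zero, Finset.sum_const_zero, sub_zero, add_zero]
    positivity
  obtain ⟨τ, hτd⟩ : ∃ τ : ℝ, τ = parabolicCap b x := ⟨_, rfl⟩
  rw [← hτd] at hτ hτ0
  have hτ1 : τ ≤ 1 := by rw [hτd]; exact parabolicCap_le_one hb0.le x
  have hφτ : φ x = τ ^ (k + 3) := by rw [hτd]
  obtain ⟨y, hy⟩ : ∃ y : ℝ, y = ‖gradient u x‖ := ⟨_, rfl⟩
  have hy0 : 0 ≤ y := by rw [hy]; positivity
  obtain ⟨B, hB⟩ : ∃ B : ℝ, B = Λ * (1 + ‖x‖) / τ := ⟨_, rfl⟩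
  have hx0 := norm_nonneg x
  have hBτ : B * τ = Λ * (1 + ‖x‖) := by rw [hB]; field_simp
  have hB' : Λ * (1 + ‖x‖) ≤ B := by rw [hB]; exact le_div_self (by positivity) hτ hτ1
  have hB1 : 1 ≤ B := le_trans (by nlinarith) hB'
  have hS : ∑ i, partialDeriv i w x ^ 2 = y ^ 2 := by
    rw [hy, norm_gradient_sq]; simp_rw [hpw]
  have hin : |∑ i, x i * partialDeriv i w x| ≤ ‖x‖ * y := by
    simp_rw [hpw]
    rw [← inner_self_gradient, hy]
    exact abs_real_inner_le_norm _ _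
  -- The terms containing derivatives of the cutoff, divided by the cutoff.
  obtain ⟨G, hG⟩ : ∃ G : ℝ, G = -(2 * γ) * (∑ i, x i * partialDeriv i w x) / τ := ⟨_, rfl⟩
  obtain ⟨d, hd⟩ : ∃ d : ℝ, d = -(2 * γ) * (n * τ - 2 * b * (k + 2) * ‖x‖ ^ 2) / τ ^ 2 := ⟨_, rfl⟩
  obtain ⟨hg, hhg⟩ : ∃ hg : ℝ, hg = -(2 * γ) * (∑ i, ∑ j, x i * partialDeriv j w x
      * partialDeriv i (partialDeriv j w) x) / τ := ⟨_, rfl⟩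
  have eG : ∑ i, partialDeriv i φ x * partialDeriv i w x = φ x * G := by
    have e : ∀ i, partialDeriv i φ x * partialDeriv i w x
        = -(2 * γ) * τ ^ (k + 2) * (x i * partialDeriv i w x) := by
      intro i; rw [hd1, hτd]; ring
    simp only [e, ← Finset.mul_sum]
    rw [hφτ, hG]
    field_simp
    ring
  have ehg : ∑ i, ∑ j, partialDeriv i φ x * partialDeriv j w x
      * partialDeriv i (partialDeriv j w) x = φ x * hg := by
    have e : ∀ i j, partialDeriv i φ x * partialDeriv j w x * partialDeriv i (partialDeriv j w) x
        = -(2 * γ) * τ ^ (k + 2)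
          * (x i * partialDeriv j w x * partialDeriv i (partialDeriv j w) x) := by
      intro i j; rw [hd1, hτd]; ring
    simp only [e, ← Finset.mul_sum]
    rw [hφτ, hhg]
    field_simp
    ring
  have ed : ∑ i, partialDeriv i (partialDeriv i φ) x = φ x * d := by
    rw [hd2, ← hτd, hφτ, hd]
    field_simp
    ring
  have hΛxy : Λ * (‖x‖ * y) ≤ Λ * (1 + ‖x‖) * y := by
    rw [← mul_assoc]
    gcongr
    exact le_add_of_nonneg_left zero_le_one
  have bG : |G| ≤ B * y := by
    rw [hG, abs_div, abs_mul, abs_neg, abs_of_pos (by positivity : 0 < 2 * γ), abs_of_pos hτ,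
      div_le_iff₀ hτ]
    calc 2 * γ * |∑ i, x i * partialDeriv i w x| ≤ Λ * (‖x‖ * y) := by gcongr
      _ ≤ Λ * (1 + ‖x‖) * y := hΛxy
      _ = B * y * τ := by rw [← hBτ]; ring
  have bd : |d| ≤ B ^ 2 := by
    rw [hd, hB]
    exact abs_laplacian_cutoff_div_le hb0 hbγ hΛ1 hΛγ hΛγ' hτ hτ1 hx0
  have bT : |∑ i, partialDeriv i (partialDeriv i w) x + w x ^ p|
      ≤ B * y + (p + β) * w x ^ max (p - 1) 1 := by
    have heq := hu.equation x
    rw [laplacian_eq_sum_partialDeriv hu.contDiff, inner_self_gradient] at heq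
    simp_rw [hpw] at hin ⊢
    have : ∑ i, partialDeriv i (partialDeriv i u) x + w x ^ p
        = lam * (∑ i, x i * partialDeriv i u x) + ((u x + 1) ^ p - u x ^ p + β * u x) := by
      rw [hw]; linarith
    rw [this]
    refine (abs_add_le _ _).trans (add_le_add ?_ (abs_add_one_rpow_sub_le hp hβ (hu.nonneg x)))
    rw [abs_mul, abs_of_pos hlam]
    calc lam * |∑ i, x i * partialDeriv i u x| ≤ Λ * (‖x‖ * y) := by gcongr
      _ ≤ Λ * (1 + ‖x‖) * y := hΛxy
      _ ≤ B * y := by gcongr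
  have bH : 1 / (n : ℝ) * (∑ i, partialDeriv i (partialDeriv i w) x - m * (y ^ 2 / w x)) ^ 2
      ≤ (∑ i, ∑ j, partialDeriv i (partialDeriv j w) x ^ 2)
        - 2 * m * ((∑ i, ∑ j, partialDeriv i w x * partialDeriv j w x
            * partialDeriv i (partialDeriv j w) x) / w x) + m ^ 2 * (y ^ 2 / w x) ^ 2 := by
    have h := trace_sub_sq_le (by omega : 0 < n) (fun i j => partialDeriv i (partialDeriv j w) x)
      (fun i => partialDeriv i w x) (m / w x)
    rw [hS] at h
    have e1 : m * (y ^ 2 / w x) = m / w x * y ^ 2 := by ring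
    rw [e1]
    refine h.trans (le_of_eq ?_)
    ring
  have hkey := key (w x) (y ^ 2) y B G d _ hg _ _ (hw1 x) hy0 rfl hB1 bG bd bT bH
  have hφB : φ x * B ^ Q ≤ Λ ^ Q * ((1 + ‖x‖) ^ Q * Real.exp (-(γ / 2 * ‖x‖ ^ 2))) := by
    rw [hφτ, hB]
    exact cutoff_mul_pow_le hbγ hb0 (by linarith) hτ
      (by rw [hτd]; exact parabolicCap_le_exp b x) hx0 hN
  rw [eG, ehg, ed, hS, ← hy]
  have h1 := mul_le_mul_of_nonneg_left hkey (hφ0 x)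
  have h2 := mul_le_mul_of_nonneg_left hφB hC
  refine le_trans (le_of_eq ?_) (h1.trans ?_)
  · ring
  · linarith

theorem mainTheorem2 (n : ℕ) (hn : 2 ≤ n) (p : ℝ) (hp : 1 < p)
    (hp' : (p : EReal) < sobolevExponent n) (lam β : ℝ) (hlam : 0 < lam) (hβ : 0 ≤ β)
    (u : EuclideanSpace ℝ (Fin n) → ℝ) (hu : IsNonnegClassicalSolution n p lam β u)
    (γ : ℝ) (hγ : 0 < γ) :
    Integrable (fun x : EuclideanSpace ℝ (Fin n) =>
      (u x ^ (p + 1) + ‖gradient u x‖ ^ 2) * Real.exp (-γ * ‖x‖ ^ 2)) volume := by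
  obtain ⟨C, N₀, hN₀, hC⟩ := exists_integral_cutoff_le hn hp hp' hlam hβ hu hγ
  have hgrad : Continuous fun x => ‖gradient u x‖ ^ 2 := by
    simp_rw [norm_gradient_sq]
    exact continuous_finsetSum _ fun i _ =>
      (continuous_partialDeriv (hu.contDiff.of_le (by norm_num))).pow 2
  have hu1 : ∀ x, 0 < u x + 1 := fun x => by linarith [hu.nonneg x]
  have hE : Continuous fun x => (u x + 1) ^ (p + 1) + ‖gradient u x‖ ^ 2 :=
    ((hu.contDiff.continuous.add continuous_const).rpow_const
      fun x => Or.inl (hu1 x).ne').add hgrad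
  have hE0 : ∀ x, 0 ≤ (u x + 1) ^ (p + 1) + ‖gradient u x‖ ^ 2 := fun x => by
    have := (hu1 x).le
    positivity
  have hcap : ∀ N : ℕ, Continuous fun x : EuclideanSpace ℝ (Fin n) =>
      parabolicCap (γ / N) x ^ N := fun N => by
    unfold parabolicCap
    fun_prop
  -- Fatou's lemma as the cutoffs tend to the Gaussian.
  have hlim : ∀ x, Filter.Tendsto (fun N : ℕ => ENNReal.ofReal (parabolicCap (γ / N) x ^ N
      * ((u x + 1) ^ (p + 1) + ‖gradient u x‖ ^ 2))) Filter.atTop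
      (nhds (ENNReal.ofReal (Real.exp (-γ * ‖x‖ ^ 2)
        * ((u x + 1) ^ (p + 1) + ‖gradient u x‖ ^ 2)))) := fun x =>
    (ENNReal.continuous_ofReal.tendsto _).comp ((tendsto_parabolicCap_pow x).mul_const _)
  have hint : Integrable (fun x => Real.exp (-γ * ‖x‖ ^ 2)
      * ((u x + 1) ^ (p + 1) + ‖gradient u x‖ ^ 2)) volume := by
    have hcont : Continuous fun x => Real.exp (-γ * ‖x‖ ^ 2)
        * ((u x + 1) ^ (p + 1) + ‖gradient u x‖ ^ 2) := by
      refine Continuous.mul (by fun_prop) hE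
    refine ⟨hcont.aestronglyMeasurable, ?_⟩
    rw [hasFiniteIntegral_iff_ofReal (Filter.Eventually.of_forall fun x =>
      mul_nonneg (Real.exp_pos _).le (hE0 x))]
    refine lt_of_le_of_lt ?_ (ENNReal.ofReal_lt_top (r := C))
    calc ∫⁻ x, ENNReal.ofReal (Real.exp (-γ * ‖x‖ ^ 2)
          * ((u x + 1) ^ (p + 1) + ‖gradient u x‖ ^ 2))
        = ∫⁻ x, Filter.liminf (fun N : ℕ => ENNReal.ofReal (parabolicCap (γ / N) x ^ N
            * ((u x + 1) ^ (p + 1) + ‖gradient u x‖ ^ 2))) Filter.atTop :=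
          lintegral_congr fun x => (hlim x).liminf_eq.symm
      _ ≤ Filter.liminf (fun N : ℕ => ∫⁻ x, ENNReal.ofReal (parabolicCap (γ / N) x ^ N
            * ((u x + 1) ^ (p + 1) + ‖gradient u x‖ ^ 2))) Filter.atTop :=
          lintegral_liminf_le fun N => (((hcap N).mul hE).measurable).ennreal_ofReal
      _ ≤ ENNReal.ofReal C := by
          refine Filter.liminf_le_of_frequently_le' (Filter.Eventually.frequently ?_)
          filter_upwards [Filter.eventually_ge_atTop N₀] with N hN
          have hN0 : (0 : ℝ) < N := by exact_mod_cast (by omega : 0 < N)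
          rw [← ofReal_integral_eq_lintegral_ofReal (f := fun x => parabolicCap (γ / N) x ^ N
            * ((u x + 1) ^ (p + 1) + ‖gradient u x‖ ^ 2))
            (((hcap N).mul hE).integrable_of_hasCompactSupport
              (hasCompactSupport_parabolicCap_pow (by positivity) (by omega)).mul_right)
            (Filter.Eventually.of_forall fun x =>
              mul_nonneg (pow_nonneg (parabolicCap_nonneg _ x) _) (hE0 x))]
          exact ENNReal.ofReal_le_ofReal (hC N hN)
  refine hint.mono' (((hu.contDiff.continuous.rpow_const fun x => Or.inr (by linarith)).add
    hgrad).mul (by fun_prop)).aestronglyMeasurable (Filter.Eventually.of_forall fun x => ?_)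
  have hux := hu.nonneg x
  rw [Real.norm_of_nonneg (by positivity), mul_comm]
  gcongr
  linarith
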